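/- Let $k\in\mathbb{N}$, let $R=[r^1,\dots,r^k]\in\mathbb{Q}^{2\times k}$ have non-zero columns, let $f\in\mathbb{Q}^2\setminus\mathbb{Z}^2$, and assume that $$P(R,f):=\{(x,s)\in\mathbb{Z}^2\times\mathbb{R}^k_{+} \mid f+Rs=x\}$$ is non-empty. Let $P(R,f)^0:=\{(x,s)\in\mathbb{R}^2\times\mathbb{R}^k_{+}\mid f+Rs=x\}$ be its linear programming relaxation. For a set $C\subseteq\mathbb{R}^2\times\mathbb{R}^k$, the split closure of $C$ is $$\bigcap_{\pi\in\mathbb{Z}^2,\ \pi_0\in\mathbb{Z}}\operatorname{conv}\Big(\big(C\cap\{(x,s)\mid\pi^Tx\le\pi_0\}\big)\cup\big(C\cap\{(x,s)\mid\pi^Tx\ge\pi_0+1\}\big)\Big).$$ Let $P(R,f)^{n}$ be the set obtained from $P(R,f)^0$ by taking the split closure $n$ times. The split rank of a linear inequality (with respect to $P(R,f)^0$) is the smallest $n\ge 0$ such that the inequality is valid for $P(R,f)^{n}$; it is $+\infty$ if there is no such $n$. For $\alpha\in\mathbb{R}^k_{+}$, the set induced by the inequality $\sum_{i=1}^k\alpha_is_i\ge1$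 is $$L_\alpha:=\operatorname{conv}\Big(\Big\{f+\frac{r^i}{\alpha_i}\ \Big|\ \alpha_i>0\Big\}\cup\{f\}\Big)+\operatorname{cone}\{r^i\mid\alpha_i=0\}.$$ A (non-degenerate) triangle $T\subset\mathbb{R}^2$ is of type $T^{2A}$ if its interior contains no point of $\mathbb{Z}^2$ and it has a vertex $v\notin\mathbb{Z}^2$ such that the side opposite to $v$ contains at least two integer points (end points included) and each of the two sides incident to $v$ contains exactly one integer point in its relative interior. Then the following holds. If $\alpha\in\mathbb{R}^k_{+}$ is such that the inequality $\sum_{i=1}^k\alpha_is_i\ge1$ is valid for $\operatorname{conv}(P(R,f))$ and $L_\alpha$ is a triangle of type $T^{2A}$, then the split rank of $\sum_{i=1}^k\alpha_is_i\ge1$ with respect to $P(R,f)^0$ is finite. -/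

import Mathlib

open scoped Pointwise

/-- The points of `ℝᵈ` all of whose coordinates are integers. -/
def integerPoints (d : ℕ) : Set (Fin d → ℝ) :=
  {x | ∀ i, ∃ n : ℤ, x i = (n : ℝ)}

/-- The inequality `aᵀx + bᵀy ≤ c` is valid for the set `C` of points `(x, y)`. -/
def IsValidIneq {p q : ℕ} (C : Set ((Fin p → ℝ) × (Fin q → ℝ)))
    (a : Fin p → ℝ) (b : Fin q → ℝ) (c : ℝ) : Prop :=
  ∀ z ∈ C, ∑ i, a i * z.1 i + ∑ j, b j * z.2 j ≤ c

/-- Convex hull of the points of `C` that satisfy the disjunction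
`πᵀx ≤ π₀` or `πᵀx ≥ π₀ + 1`. -/
def splitHull {p q : ℕ} (C : Set ((Fin p → ℝ) × (Fin q → ℝ)))
    (π : Fin p → ℤ) (π₀ : ℤ) : Set ((Fin p → ℝ) × (Fin q → ℝ)) :=
  convexHull ℝ
    ((C ∩ {z | ∑ i, (π i : ℝ) * z.1 i ≤ (π₀ : ℝ)}) ∪
      (C ∩ {z | (π₀ : ℝ) + 1 ≤ ∑ i, (π i : ℝ) * z.1 i}))

/-- The split closure of `C`: the intersection of the hulls over all split disjunctions. -/
def splitClosure {p q : ℕ} (C : Set ((Fin p → ℝ) × (Fin q → ℝ))) :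
    Set ((Fin p → ℝ) × (Fin q → ℝ)) :=
  ⋂ (π : Fin p → ℤ) (π₀ : ℤ), splitHull C π π₀

/-- The split rank of `aᵀx + bᵀy ≤ c` with respect to `C`: the least `n` such that the
inequality is valid for the `n`-th split closure of `C`, and `⊤` if there is none. -/
noncomputable def splitRank {p q : ℕ} (C : Set ((Fin p → ℝ) × (Fin q → ℝ)))
    (a : Fin p → ℝ) (b : Fin q → ℝ) (c : ℝ) : ℕ∞ :=
  ⨅ (n : ℕ) (_ : IsValidIneq (splitClosure^[n] C) a b c), (n : ℕ∞)

/-- The linear relaxation `{(x, s) ∈ ℝ² × ℝᵏ | f + R s = x, s ≥ 0}` of `P(R, f)`. -/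
def relaxation {k : ℕ} (R : Matrix (Fin 2) (Fin k) ℚ) (f : Fin 2 → ℚ) :
    Set ((Fin 2 → ℝ) × (Fin k → ℝ)) :=
  {z | (∀ i, (f i : ℝ) + ∑ j, (R i j : ℝ) * z.2 j = z.1 i) ∧ ∀ j, 0 ≤ z.2 j}

/-- The mixed integer set `P(R, f) = {(x, s) ∈ ℤ² × ℝᵏ | f + R s = x, s ≥ 0}`. -/
def mixedIntegerSet {k : ℕ} (R : Matrix (Fin 2) (Fin k) ℚ) (f : Fin 2 → ℚ) :
    Set ((Fin 2 → ℝ) × (Fin k → ℝ)) :=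
  {z | z ∈ relaxation R f ∧ z.1 ∈ integerPoints 2}

/-- The rational point `f`, as a point of `ℝ²`. -/
def realPoint (f : Fin 2 → ℚ) : Fin 2 → ℝ := fun i => (f i : ℝ)

/-- The `j`-th column `rʲ` of `R`, as a vector of `ℝ²`. -/
def column {k : ℕ} (R : Matrix (Fin 2) (Fin k) ℚ) (j : Fin k) : Fin 2 → ℝ :=
  fun i => (R i j : ℝ)

/-- The set `L_α = conv({f + rʲ/αⱼ | αⱼ > 0} ∪ {f}) + cone{rʲ | αⱼ = 0}` induced by the
inequality `∑ αⱼ sⱼ ≥ 1`, for `α ≥ 0`. -/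
def inducedSet {k : ℕ} (R : Matrix (Fin 2) (Fin k) ℚ) (f : Fin 2 → ℚ) (α : Fin k → ℝ) :
    Set (Fin 2 → ℝ) :=
  convexHull ℝ
      ({y | ∃ j, 0 < α j ∧ y = realPoint f + (α j)⁻¹ • column R j} ∪ {realPoint f}) +
    {y | ∃ c : Fin k → ℝ, (∀ j, 0 ≤ c j) ∧ (∀ j, α j ≠ 0 → c j = 0) ∧
      y = ∑ j, c j • column R j}

/-- No integer point lies in the interior of `S`. -/
def IsLatticeFree (S : Set (Fin 2 → ℝ)) : Prop :=
  interior S ∩ integerPoints 2 = ∅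

/-- Triangles of type `T^{2A}`: lattice-free, with a non-integral vertex `v` whose opposite
side contains at least two integer points (end points count), while each of the two sides at
`v` contains exactly one integer point in its relative interior. -/
def IsTriangleT2A (T : Set (Fin 2 → ℝ)) : Prop :=
  IsLatticeFree T ∧
  ∃ v a b : Fin 2 → ℝ,
    AffineIndependent ℝ ![v, a, b] ∧
    T = convexHull ℝ {v, a, b} ∧
    v ∉ integerPoints 2 ∧
    (segment ℝ a b ∩ integerPoints 2).Nontrivial ∧
    (∃! p, p ∈ openSegment ℝ v a ∩ integerPoints 2) ∧
    (∃! p, p ∈ openSegment ℝ v b ∩ integerPoints 2)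

/-! Write `σ = ∑ j, α j * s j`; the goal is `1 ≤ σ` after finitely many closures. An affine `u` that
is nonnegative on `L_α` and positive at `f` gives `1 - u x / u f ≤ σ` on the relaxation
(`one_sub_le_cost`), so the three sides of the triangle give three bounds, each equal to `1` along
its side. In suitable unimodular coordinates `(X, Y)` the base lies on `Y = 0` and extends beyond
`[0, 1]` at both ends, and the other sides pass through `(0, 1)` and `(1, 1)`
(`exists_coordinates_of_isTriangleT2A`).

For `X ≤ 0` the left side, and for `X ≥ 1` the right side, yields a bound with value `1` at `Y = 1`
and some positive slope in `Y`. Mixing each with the current constant bound `μ` equalises the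
slopes, so a split on `X` applies; a split on `Y` then makes the result constant, as the base bound
handles `Y ≤ 0`. Such a round multiplies `1 - μ` by a fixed `1 - τ < 1`, which converges to the goal
without reaching it.

The gap is closed by splits parallel to the left and right sides: once `1 - μ < ε`, they reduce the
slopes of these two bounds to `ε`. The steep and the flat version together give one common slope
with no loss at `Y = 1`, and a last pair of splits on `X` and `Y` yields `1 ≤ σ`
(`exists_one_le_of_split_steps`). The parallel splits have integer normals because the ends of the
base are rational, being points where rational rays from `f` meet the base line. -/

/-! ### The finite sequence of splits -/

/-- Three affine lower bounds on `σ` that describe a lattice-free triangle with horizontal base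
at height `0`, whose other sides pass through `(0, 1)` and `(1, 1)`, can be strengthened to the
bound `1 ≤ σ` by finitely many splits. -/
theorem exists_one_le_of_split_steps {E : Type*} (V : ℕ → Set E) (σ X Y : E → ℝ)
    (step : ∀ (m₁ m₂ m₀ : ℤ) (n : ℕ) (α β γ : ℝ),
      (∀ z ∈ V n, m₁ * X z + m₂ * Y z ≤ m₀ → α + β * X z + γ * Y z ≤ σ z) →
      (∀ z ∈ V n, (m₀ : ℝ) + 1 ≤ m₁ * X z + m₂ * Y z → α + β * X z + γ * Y z ≤ σ z) →
      ∀ z ∈ V (n + 1), α + β * X z + γ * Y z ≤ σ z)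
    {N M N' M' : ℤ} (hN : 0 < N) (hM : 0 < M) (hN' : 0 < N') (hM' : 0 < M')
    {c₁ c₂ c₃ : ℝ} (hc₁ : 0 < c₁) (hc₂ : 0 < c₂) (hc₃ : 0 < c₃)
    (h₁ : ∀ z ∈ V 0, 1 - c₁ * (N * X z + M * (1 - Y z)) ≤ σ z)
    (h₂ : ∀ z ∈ V 0, 1 - c₂ * (N' * (1 - X z) + M' * (1 - Y z)) ≤ σ z)
    (h₃ : ∀ z ∈ V 0, 1 - c₃ * Y z ≤ σ z) (h₀ : ∀ z ∈ V 0, 0 ≤ σ z) :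
    ∃ n, ∀ z ∈ V n, 1 ≤ σ z := by
  have mono : ∀ (α β γ : ℝ) (n k : ℕ), (∀ z ∈ V n, α + β * X z + γ * Y z ≤ σ z) →
      ∀ z ∈ V (n + k), α + β * X z + γ * Y z ≤ σ z := by
    intro α β γ n k h
    induction k with
    | zero => exact h
    -- The trivial split `0 ≤ 0` or `0 ≥ 1` carries a bound to the next closure.
    | succ k ih => exact step 0 0 0 (n + k) α β γ (fun z hz _ => ih z hz) (fun z hz _ => ih z hz)
  have g₁ : ∀ n, ∀ z ∈ V n, 1 - c₁ * (N * X z + M * (1 - Y z)) ≤ σ z := by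
    intro n z hz
    have := mono (1 - c₁ * M) (-(c₁ * N)) (c₁ * M) 0 n
      (fun z hz => by linarith [h₁ z hz]) z (by simpa using hz)
    linarith
  have g₂ : ∀ n, ∀ z ∈ V n, 1 - c₂ * (N' * (1 - X z) + M' * (1 - Y z)) ≤ σ z := by
    intro n z hz
    have := mono (1 - c₂ * (N' + M')) (c₂ * N') (c₂ * M') 0 n
      (fun z hz => by linarith [h₂ z hz]) z (by simpa using hz)
    linarith
  have g₃ : ∀ n, ∀ z ∈ V n, 1 - c₃ * Y z ≤ σ z := by
    intro n z hz
    have := mono 1 0 (-c₃) 0 n (fun z hz => by linarith [h₃ z hz]) z (by simpa using hz)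
    linarith
  have hNr : (0 : ℝ) < N := by exact_mod_cast hN
  have hMr : (0 : ℝ) < M := by exact_mod_cast hM
  have hNr' : (0 : ℝ) < N' := by exact_mod_cast hN'
  have hMr' : (0 : ℝ) < M' := by exact_mod_cast hM'
  have left : ∀ n, ∀ z ∈ V n, X z ≤ 0 → 1 + c₁ * M * (Y z - 1) ≤ σ z := by
    intro n z hz hX
    have := g₁ n z hz
    have : c₁ * N * X z ≤ 0 := mul_nonpos_of_nonneg_of_nonpos (by positivity) hX
    linarith
  have right : ∀ n, ∀ z ∈ V n, 1 ≤ X z → 1 + c₂ * M' * (Y z - 1) ≤ σ z := by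
    intro n z hz hX
    have := g₂ n z hz
    have : 0 ≤ c₂ * N' * (X z - 1) := mul_nonneg (by positivity) (by linarith)
    linarith
  -- splitting on `Y` turns a bound increasing in `Y` into a constant one
  have flatten : ∀ n μ κ, 0 ≤ κ → μ ≤ 1 → (∀ z ∈ V n, μ + κ * (Y z - 1) ≤ σ z) →
      ∀ z ∈ V (n + 1), μ ≤ σ z := by
    intro n μ κ hκ hμ h z hz
    have := step 0 1 0 n μ 0 0
      (fun z hz hY => by
        have h3 := g₃ n z hz
        have : c₃ * Y z ≤ 0 := mul_nonpos_of_nonneg_of_nonpos hc₃.le (by simpa using hY)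
        linarith)
      (fun z hz hY => by
        have h3 := h z hz
        have : 0 ≤ κ * (Y z - 1) := mul_nonneg hκ (by
          have : (1 : ℝ) ≤ Y z := by simpa using hY
          linarith)
        linarith) z hz
    linarith
  -- splitting on `X`
  have splitX : ∀ n μ κ, (∀ z ∈ V n, X z ≤ 0 → μ + κ * (Y z - 1) ≤ σ z) →
      (∀ z ∈ V n, 1 ≤ X z → μ + κ * (Y z - 1) ≤ σ z) →
      ∀ z ∈ V (n + 1), μ + κ * (Y z - 1) ≤ σ z := by
    intro n μ κ hl hr z hz
    have := step 1 0 0 n (μ - κ) 0 κ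
      (fun z hz hX => by linarith [hl z hz (by simpa using hX)])
      (fun z hz hX => by linarith [hr z hz (by simpa using hX)]) z hz
    linarith
  obtain ⟨lam, hlam, hl₁, hl₂⟩ : ∃ lam : ℝ, 0 < lam ∧ lam ≤ c₁ * M ∧ lam ≤ c₂ * M' :=
    ⟨min (c₁ * M) (c₂ * M'), lt_min (by positivity) (by positivity), min_le_left _ _,
      min_le_right _ _⟩
  have hmul : ∀ (t a b s : ℝ), 0 ≤ t → t ≤ 1 → a ≤ s → b ≤ s → t * a + (1 - t) * b ≤ s := by
    intro t a b s h0 h1 ha hb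
    nlinarith [mul_le_mul_of_nonneg_left ha h0, mul_le_mul_of_nonneg_left hb (sub_nonneg.2 h1)]
  -- the constant bound improves geometrically
  obtain ⟨τ, hτ, hτ1, hτ₁, hτ₂⟩ : ∃ τ : ℝ, 0 < τ ∧ τ ≤ 1 ∧ τ * (c₁ * M) ≤ lam ∧
      τ * (c₂ * M') ≤ lam := by
    refine ⟨lam / (c₁ * M + c₂ * M' + lam), by positivity, ?_, ?_, ?_⟩
    · rw [div_le_one (by positivity)]
      have : 0 < c₁ * M := by positivity
      have : 0 < c₂ * M' := by positivity
      linarith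
    all_goals
      rw [div_mul_eq_mul_div, div_le_iff₀ (by positivity)]
      apply mul_le_mul_of_nonneg_left _ hlam.le
      have : 0 < c₁ * M := by positivity
      have : 0 < c₂ * M' := by positivity
      linarith
  have improve : ∀ n μ, μ ≤ 1 → (∀ z ∈ V n, μ ≤ σ z) →
      ∀ z ∈ V (n + 2), 1 - (1 - τ) * (1 - μ) ≤ σ z := by
    intro n μ hμ h
    have key : ∀ c, 0 < c → lam ≤ c → τ * c ≤ lam → ∀ z ∈ V n, 1 + c * (Y z - 1) ≤ σ z →
        (1 - (1 - τ) * (1 - μ)) + lam * (Y z - 1) ≤ σ z := by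
      intro c hc hlc hτc z hz hs
      -- Weight `lam / c` on the side bound lowers its slope to `lam`; the deficit left is `(1 - lam
      -- / c) * (1 - μ)`, at most `(1 - τ) * (1 - μ)`.
      have ht := hmul (lam / c) _ _ _ (by positivity) ((div_le_one hc).2 hlc) hs (h z hz)
      have e1 : lam / c * c = lam := by field_simp
      have e2 : τ ≤ lam / c := (le_div_iff₀ hc).2 hτc
      have e3 := mul_le_mul_of_nonneg_right e2 (sub_nonneg.2 hμ)
      have e4 : lam / c * (c * (Y z - 1)) = lam * (Y z - 1) := by rw [← mul_assoc, e1]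
      linarith
    apply flatten (n + 1) _ lam hlam.le
    · have := mul_nonneg (sub_nonneg.2 hτ1) (sub_nonneg.2 hμ)
      linarith
    · apply splitX
      · intro z hz hX
        exact key _ (by positivity) hl₁ hτ₁ z hz (left n z hz hX)
      · intro z hz hX
        exact key _ (by positivity) hl₂ hτ₂ z hz (right n z hz hX)
  have iter : ∀ k : ℕ, ∀ z ∈ V (2 * k), 1 - (1 - τ) ^ k ≤ σ z := by
    intro k
    induction k with
    | zero => intro z hz; simpa using h₀ z hz
    | succ k ih =>
      intro z hz
      have := improve (2 * k) _ (by
        have := pow_nonneg (sub_nonneg.2 hτ1) k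
        linarith) ih z hz
      rw [pow_succ]
      linarith
  -- `ε ≤ cᵢ` makes the tilted bounds weaker on the outer side of each line; `ε * M, ε * M' ≤ lam`
  -- puts their slopes in `Y` below the common slope.
  obtain ⟨ε, hε, hε₁, hε₂, hε₃, hε₄⟩ : ∃ ε : ℝ, 0 < ε ∧ ε ≤ c₁ ∧ ε ≤ c₂ ∧ ε * M ≤ lam ∧
      ε * M' ≤ lam := by
    refine ⟨min (min c₁ c₂) (min (lam / M) (lam / M')), by positivity, ?_, ?_, ?_, ?_⟩
    · exact (min_le_left _ _).trans (min_le_left _ _)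
    · exact (min_le_left _ _).trans (min_le_right _ _)
    · rw [← le_div_iff₀ hMr]; exact (min_le_right _ _).trans (min_le_left _ _)
    · rw [← le_div_iff₀ hMr']; exact (min_le_right _ _).trans (min_le_right _ _)
  obtain ⟨k, hk⟩ := exists_pow_lt_of_lt_one hε (show 1 - τ < 1 by linarith)
  have near : ∀ z ∈ V (2 * k), 1 - ε ≤ σ z := fun z hz => by linarith [iter k z hz]
  -- the sides through `(0, 1)` and `(1, 1)` become flat
  have flat : ∀ (u : E → ℝ) c, ε ≤ c → (∀ z ∈ V (2 * k), 1 - c * u z ≤ σ z) →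
      (∀ z ∈ V (2 * k), u z ≤ 0 → 1 - ε * u z ≤ σ z) ∧
      (∀ z ∈ V (2 * k), 1 ≤ u z → 1 - ε * u z ≤ σ z) := by
    -- For `u ≤ 0` the factor `c` may shrink to `ε`; for `u ≥ 1` the constant bound gives `1 - ε * u
    -- ≤ 1 - ε ≤ σ`.
    intro u c hc h
    constructor
    · intro z hz hu
      nlinarith [h z hz, mul_nonneg (sub_nonneg.2 hc) (neg_nonneg.2 hu)]
    · intro z hz hu
      nlinarith [near z hz, mul_nonneg hε.le (sub_nonneg.2 hu)]
  have f₁ : ∀ z ∈ V (2 * k + 1), 1 - ε * (N * X z + M * (1 - Y z)) ≤ σ z := by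
    obtain ⟨hl, hr⟩ := flat (fun z => N * X z + M * (1 - Y z)) c₁ hε₁ (g₁ _)
    intro z hz
    -- The two halves of this split are `u ≤ 0` and `u ≥ 1` for `u = N * X + M * (1 - Y)`.
    have := step N (-M) (-M) (2 * k) (1 - ε * M) (-(ε * N)) (ε * M)
      (fun z hz h => by
        push_cast at h
        linarith [hl z hz (by linarith)])
      (fun z hz h => by
        push_cast at h
        linarith [hr z hz (by linarith)]) z hz
    linarith
  have f₂ : ∀ z ∈ V (2 * k + 1), 1 - ε * (N' * (1 - X z) + M' * (1 - Y z)) ≤ σ z := by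
    obtain ⟨hl, hr⟩ := flat (fun z => N' * (1 - X z) + M' * (1 - Y z)) c₂ hε₂ (g₂ _)
    intro z hz
    have := step (-N') (-M') (-(N' + M')) (2 * k) (1 - ε * (N' + M')) (ε * N') (ε * M')
      (fun z hz h => by
        push_cast at h
        linarith [hl z hz (by linarith)])
      (fun z hz h => by
        push_cast at h
        linarith [hr z hz (by linarith)]) z hz
    linarith
  have between : ∀ (lo hi y s : ℝ), lo ≤ lam → lam ≤ hi → 1 + lo * y ≤ s → 1 + hi * y ≤ s →
      1 + lam * y ≤ s := by
    intro lo hi y s h1 h2 h3 h4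
    -- The steep bound suffices above height `1`, the flat one below.
    rcases le_total 0 y with hy | hy
    · nlinarith [mul_le_mul_of_nonneg_right h2 hy]
    · nlinarith [mul_le_mul_of_nonpos_right h1 hy]
  -- One closure each for the tilt, the split on `X` and the split on `Y`.
  refine ⟨2 * k + 1 + 1 + 1, flatten _ 1 lam hlam.le le_rfl (splitX _ 1 lam ?_ ?_)⟩
  · intro z hz hX
    refine between (ε * M) (c₁ * M) _ _ hε₃ hl₁ ?_ (left _ z hz hX)
    have := f₁ z hz
    have : ε * N * X z ≤ 0 := mul_nonpos_of_nonneg_of_nonpos (by positivity) hX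
    linarith
  · intro z hz hX
    refine between (ε * M') (c₂ * M') _ _ hε₄ hl₂ ?_ (right _ z hz hX)
    have := f₂ z hz
    have : 0 ≤ ε * N' * (X z - 1) := mul_nonneg (by positivity) (by linarith)
    linarith

/-! ### Lattice geometry of the triangle -/

/-- Normal form of a lattice-free triangle with vertices `(a, 0)`, `(b, 0)`, `(v₁, v₂)` whose base
contains `(0, 0)` and `(1, 0)`, and whose other sides carry exactly one integer point each. -/
theorem exists_int_normal_form {a b v₁ v₂ : ℝ} (hv₂ : 0 < v₂) (ha : a ≤ 0) (hb : 1 ≤ b)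
    (free : ∀ m n : ℤ, (0 : ℝ) < n → 0 < v₂ * (m - a) - (v₁ - a) * n →
      0 < v₂ * (b - m) - (b - v₁) * n → False)
    (hv : ∀ m n : ℤ, v₁ = m → v₂ = n → False)
    (hp : ∃ m n : ℤ, (0 : ℝ) < n ∧ n < v₂ ∧ v₂ * (m - a) = (v₁ - a) * n)
    (hpu : ∀ m n m' n' : ℤ, (0 : ℝ) < n → n < v₂ → v₂ * (m - a) = (v₁ - a) * n →
      (0 : ℝ) < n' → n' < v₂ → v₂ * (m' - a) = (v₁ - a) * n' → n = n')
    (hq : ∃ m n : ℤ, (0 : ℝ) < n ∧ n < v₂ ∧ v₂ * (b - m) = (b - v₁) * n)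
    (hqu : ∀ m n m' n' : ℤ, (0 : ℝ) < n → n < v₂ → v₂ * (b - m) = (b - v₁) * n →
      (0 : ℝ) < n' → n' < v₂ → v₂ * (b - m') = (b - v₁) * n' → n = n') :
    ∃ n m : ℤ, a < n ∧ n + 1 < b ∧ 1 < v₂ ∧ v₂ * (m - a) = v₁ - a ∧
      v₂ * (b - (m + 1)) = b - v₁ := by
  obtain ⟨p, pn, hp0, hp1, hpe⟩ := hp
  obtain ⟨q, qn, hq0, hq1, hqe⟩ := hq
  have hpn : (1 : ℝ) ≤ pn := by
    have : (0 : ℤ) < pn := by exact_mod_cast hp0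
    exact_mod_cast this
  have hqn : (1 : ℝ) ≤ qn := by
    have : (0 : ℤ) < qn := by exact_mod_cast hq0
    exact_mod_cast this
  have h1v : 1 < v₂ := by linarith
  -- left and right ends of the section at height `1`
  obtain ⟨l, hl⟩ : ∃ l, v₁ - a = v₂ * (l - a) := ⟨a + (v₁ - a) / v₂, by field_simp; ring⟩
  obtain ⟨r, hr⟩ : ∃ r, b - v₁ = v₂ * (b - r) := ⟨b - (b - v₁) / v₂, by field_simp; ring⟩
  have hpe' : (p : ℝ) - a = (l - a) * pn := by
    apply mul_left_cancel₀ hv₂.ne'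
    rw [hpe, hl]; ring
  have hqe' : b - (q : ℝ) = (b - r) * qn := by
    apply mul_left_cancel₀ hv₂.ne'
    rw [hqe, hr]; ring
  have hlr : v₂ * (r - l) = (b - a) * (v₂ - 1) := by linarith
  have hlr' : l < r := by
    have : 0 < (b - a) * (v₂ - 1) := mul_pos (by linarith) (by linarith)
    rw [← hlr] at this
    have := (pos_iff_pos_of_mul_pos this).1 hv₂
    linarith
  -- Otherwise `(⌊l⌋ + 1, 1)` is an interior integer point.
  have hrm : r ≤ ⌊l⌋ + 1 := by
    by_contra! hcon
    apply free (⌊l⌋ + 1) 1 (by norm_num)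
    · push_cast
      have := mul_pos hv₂ (sub_pos.2 (Int.lt_floor_add_one l))
      linarith
    · push_cast
      have := mul_pos hv₂ (sub_pos.2 hcon)
      linarith
  have hml : (⌊l⌋ : ℝ) ≤ l := Int.floor_le l
  set m : ℤ := ⌊l⌋ with hm
  -- the section at height `t ≥ 1` has ends `x` with `m * t ≤ x` and `x ≤ m * t + 1`
  have hpR : v₂ * (b - p) - (b - v₁) * pn = (b - a) * (v₂ - pn) := by linarith
  have hqL : v₂ * (q - a) - (v₁ - a) * qn = (b - a) * (v₂ - qn) := by linarith
  have hp_lt : (p : ℝ) < b - (b - r) * pn := by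
    have h1 : 0 < (b - a) * (v₂ - pn) := mul_pos (by linarith) (by linarith)
    rw [← hpR, hr] at h1
    have h2 : 0 < v₂ * (b - p - (b - r) * pn) := by linarith
    have := (pos_iff_pos_of_mul_pos h2).1 hv₂
    linarith
  have hq_gt : a + (l - a) * qn < (q : ℝ) := by
    have h1 : 0 < (b - a) * (v₂ - qn) := mul_pos (by linarith) (by linarith)
    rw [← hqL, hl] at h1
    have h2 : 0 < v₂ * (q - a - (l - a) * qn) := by linarith
    have := (pos_iff_pos_of_mul_pos h2).1 hv₂
    linarith
  have hp_eq : p = m * pn := by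
    have h1 : (m : ℝ) * pn ≤ p := by nlinarith
    have h2 : (p : ℝ) < m * pn + 1 := by nlinarith
    have h1' : m * pn ≤ p := by exact_mod_cast h1
    have h2' : p < m * pn + 1 := by exact_mod_cast h2
    omega
  have hq_eq : q = m * qn + 1 := by
    have h1 : (m : ℝ) * qn < q := by nlinarith
    have h2 : (q : ℝ) ≤ m * qn + 1 := by nlinarith
    have h1' : m * qn < q := by exact_mod_cast h1
    have h2' : q ≤ m * qn + 1 := by exact_mod_cast h2
    omega
  -- The equation becomes `a * (pn - 1) = (l - m) * pn`, with left side `≤ 0` and right side `≥ 0`.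
  have hlm : l = m := by
    rw [hp_eq] at hpe'
    push_cast at hpe'
    nlinarith
  have hrm' : r = m + 1 := by
    rw [hq_eq] at hqe'
    push_cast at hqe'
    nlinarith
  rw [hlm] at hl
  rw [hrm'] at hr
  -- The section at height `1` has length `1`; compare similar triangles.
  have hbase : v₂ = (b - a) * (v₂ - 1) := by rw [← hlr, hlm, hrm']; ring
  by_cases ha0 : a < 0
  · by_cases hb1 : 1 < b
    · exact ⟨0, m, by simpa using ha0, by simpa using hb1, h1v, hl.symm, hr.symm⟩
    · have hb1 : b = 1 := le_antisymm (not_lt.1 hb1) hb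
      subst hb1
      -- The right side starts at `(1, 0)`, so its line contains `(2 * m + 1, 2)`: a second integer
      -- point in the side if `v₂ > 2`, the vertex itself if `v₂ = 2`. Then `v₂ < 2` makes the base
      -- longer than `2`, leaving room for `[-1, 0]` inside.
      have hv2 : v₂ < 2 := by
        by_contra! h2
        rcases h2.lt_or_eq with h2 | h2
        · have := hqu (m + 1) 1 (2 * m + 1) 2 (by norm_num) (by push_cast; linarith)
            (by push_cast; linarith) (by norm_num) (by push_cast; linarith)
            (by push_cast; linarith)
          omega
        · exact hv (2 * m + 1) 2 (by push_cast; rw [← h2] at hr; linarith)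
            (by push_cast; linarith)
      refine ⟨-1, m, ?_, by norm_num, h1v, hl.symm, hr.symm⟩
      push_cast
      by_contra! h
      nlinarith
  · have ha0 : a = 0 := le_antisymm ha (not_lt.1 ha0)
    subst ha0
    have hv2 : v₂ < 2 := by
      by_contra! h2
      rcases h2.lt_or_eq with h2 | h2
      · have := hpu m 1 (2 * m) 2 (by norm_num) (by push_cast; linarith)
          (by push_cast; linarith) (by norm_num) (by push_cast; linarith)
          (by push_cast; linarith)
        omega
      · exact hv (2 * m) 2 (by push_cast; rw [← h2] at hl; linarith)
          (by push_cast; linarith)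
    refine ⟨1, m, by norm_num, ?_, h1v, hl.symm, hr.symm⟩
    push_cast
    by_contra! h
    nlinarith

/-! ### Valid inequalities and affine functionals -/

theorem convex_setOf_valid {p q : ℕ} (a : Fin p → ℝ) (b : Fin q → ℝ) (c : ℝ) :
    Convex ℝ {z : (Fin p → ℝ) × (Fin q → ℝ) |
      ∑ i, a i * z.1 i + ∑ j, b j * z.2 j ≤ c} := by
  intro z hz w hw s t hs ht hst
  simp only [Set.mem_ofPred_eq] at hz hw ⊢
  have e : ∑ i, a i * (s • z + t • w).1 i + ∑ j, b j * (s • z + t • w).2 j =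
      s * (∑ i, a i * z.1 i + ∑ j, b j * z.2 j) + t * (∑ i, a i * w.1 i + ∑ j, b j * w.2 j) := by
    simp only [Prod.fst_add, Prod.snd_add, Prod.smul_fst, Prod.smul_snd, Pi.add_apply,
      Pi.smul_apply, smul_eq_mul, mul_add, Finset.sum_add_distrib, Finset.mul_sum]
    have e1 : ∀ i (x : ℝ), a i * (s * x) = s * (a i * x) := fun _ _ => by ring
    have e2 : ∀ i (x : ℝ), a i * (t * x) = t * (a i * x) := fun _ _ => by ring
    have e3 : ∀ i (x : ℝ), b i * (s * x) = s * (b i * x) := fun _ _ => by ring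
    have e4 : ∀ i (x : ℝ), b i * (t * x) = t * (b i * x) := fun _ _ => by ring
    simp only [e1, e2, e3, e4]
    ring
  rw [e]
  calc _ ≤ s * c + t * c := by gcongr
    _ = c := by rw [← add_mul, hst, one_mul]

/-- An inequality valid on both sides of a split is valid for the split closure. -/
theorem isValidIneq_splitClosure {p q : ℕ} {C : Set ((Fin p → ℝ) × (Fin q → ℝ))}
    {a : Fin p → ℝ} {b : Fin q → ℝ} {c : ℝ} (π : Fin p → ℤ) (π₀ : ℤ)
    (h₁ : IsValidIneq (C ∩ {z | ∑ i, (π i : ℝ) * z.1 i ≤ (π₀ : ℝ)}) a b c)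
    (h₂ : IsValidIneq (C ∩ {z | (π₀ : ℝ) + 1 ≤ ∑ i, (π i : ℝ) * z.1 i}) a b c) :
    IsValidIneq (splitClosure C) a b c := by
  intro z hz
  have hz' : z ∈ splitHull C π π₀ := Set.mem_iInter.1 (Set.mem_iInter.1 hz π) π₀
  exact convexHull_min (Set.union_subset h₁ h₂) (convex_setOf_valid a b c) hz'

/-- The affine functional `x ↦ A x₀ + B x₁ + c` on the plane. -/
def planeAffine (A B c : ℝ) : (Fin 2 → ℝ) →ᵃ[ℝ] ℝ :=
  ((A • LinearMap.proj 0 + B • LinearMap.proj 1 : (Fin 2 → ℝ) →ₗ[ℝ] ℝ)).toAffineMap +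
    AffineMap.const ℝ _ c

@[simp] theorem planeAffine_apply (A B c : ℝ) (x : Fin 2 → ℝ) :
    planeAffine A B c x = A * x 0 + B * x 1 + c := by
  simp [planeAffine]

@[simp] theorem planeAffine_linear_apply (A B c : ℝ) (x : Fin 2 → ℝ) :
    (planeAffine A B c).linear x = A * x 0 + B * x 1 := by
  simp [planeAffine]

/-! ### Cost bounds from the induced set -/

section InducedSet

variable {k : ℕ} {R : Matrix (Fin 2) (Fin k) ℚ} {f : Fin 2 → ℚ} {α : Fin k → ℝ}

theorem realPoint_mem_inducedSet : realPoint f ∈ inducedSet R f α :=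
  Set.mem_add.2 ⟨realPoint f, subset_convexHull ℝ _ (Or.inr rfl), 0,
    ⟨0, by simp, by simp, by simp⟩, by simp⟩

theorem add_inv_smul_column_mem_inducedSet {j : Fin k} (hj : 0 < α j) :
    realPoint f + (α j)⁻¹ • column R j ∈ inducedSet R f α :=
  Set.mem_add.2 ⟨_, subset_convexHull ℝ _ (Or.inl ⟨j, hj, rfl⟩), 0,
    ⟨0, by simp, by simp, by simp⟩, by simp⟩

theorem add_smul_column_mem_inducedSet {j : Fin k} (hj : α j = 0) {c : ℝ} (hc : 0 ≤ c) :
    realPoint f + c • column R j ∈ inducedSet R f α := by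
  refine Set.mem_add.2 ⟨realPoint f, subset_convexHull ℝ _ (Or.inr rfl), c • column R j,
    ⟨Pi.single j c, ?_, ?_, ?_⟩, rfl⟩
  · intro i
    rcases eq_or_ne i j with rfl | h
    · simpa using hc
    · simp [Pi.single_eq_of_ne h]
  · intro i hi
    have : i ≠ j := by rintro rfl; exact hi hj
    simp [Pi.single_eq_of_ne this]
  · rw [Finset.sum_eq_single j]
    · simp
    · intro i _ h; simp [Pi.single_eq_of_ne h]
    · simp

/-- Points of the induced set are reached from `f` at cost at most one. -/
theorem exists_cost_le_one_of_mem_inducedSet (hα : ∀ j, 0 ≤ α j) {y : Fin 2 → ℝ}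
    (hy : y ∈ inducedSet R f α) :
    ∃ s : Fin k → ℝ, (∀ j, 0 ≤ s j) ∧ ∑ j, α j * s j ≤ 1 ∧
      y = realPoint f + ∑ j, s j • column R j := by
  obtain ⟨y₁, hy₁, y₂, ⟨c, hc, hc0, rfl⟩, rfl⟩ := Set.mem_add.1 hy
  have conv : Convex ℝ {y | ∃ s : Fin k → ℝ, (∀ j, 0 ≤ s j) ∧ ∑ j, α j * s j ≤ 1 ∧
      y = realPoint f + ∑ j, s j • column R j} := by
    rintro _ ⟨s, hs, hs1, rfl⟩ _ ⟨t, ht, ht1, rfl⟩ u w hu hw huw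
    refine ⟨fun j => u * s j + w * t j, fun j => ?_, ?_, ?_⟩
    · have := mul_nonneg hu (hs j); have := mul_nonneg hw (ht j); positivity
    · calc ∑ j, α j * (u * s j + w * t j) = u * ∑ j, α j * s j + w * ∑ j, α j * t j := by
            rw [Finset.mul_sum, Finset.mul_sum, ← Finset.sum_add_distrib]
            exact Finset.sum_congr rfl fun j _ => by ring
        _ ≤ u * 1 + w * 1 := by gcongr
        _ = 1 := by linarith
    · have hw' : realPoint f = u • realPoint f + w • realPoint f := by
        rw [← add_smul, huw, one_smul]
      conv_rhs => rw [hw']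
      simp only [add_smul, mul_smul, Finset.sum_add_distrib, smul_add, Finset.smul_sum]
      abel
  have h₁ := convexHull_min (t := _) ?_ conv hy₁
  · obtain ⟨s, hs, hs1, rfl⟩ := h₁
    refine ⟨fun j => s j + c j, fun j => add_nonneg (hs j) (hc j), ?_, ?_⟩
    · have : ∀ j, α j * (s j + c j) = α j * s j := by
        intro j
        rcases eq_or_ne (α j) 0 with h | h
        · simp [h]
        · simp [hc0 j h]
      simpa [this] using hs1
    · simp only [add_smul, Finset.sum_add_distrib, add_assoc]
  · rintro y (⟨j, hj, rfl⟩ | rfl)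
    · refine ⟨Pi.single j (α j)⁻¹, fun i => ?_, ?_, ?_⟩
      · rcases eq_or_ne i j with rfl | h
        · simpa using hα i
        · simp [Pi.single_eq_of_ne h]
      · rw [Finset.sum_eq_single j]
        · simp [hj.ne']
        · intro i _ h; simp [Pi.single_eq_of_ne h]
        · simp
      · rw [Finset.sum_eq_single j]
        · simp
        · intro i _ h; simp [Pi.single_eq_of_ne h]
        · simp
    · exact ⟨0, by simp, by simp, by simp⟩

theorem map_add_sum_columns (u : (Fin 2 → ℝ) →ᵃ[ℝ] ℝ) (s : Fin k → ℝ) :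
    u (realPoint f + ∑ j, s j • column R j) =
      u (realPoint f) + ∑ j, s j * u.linear (column R j) := by
  rw [add_comm, ← vadd_eq_add, u.map_vadd, map_sum, vadd_eq_add, add_comm]
  simp

theorem map_add_smul_column (u : (Fin 2 → ℝ) →ᵃ[ℝ] ℝ) (c : ℝ) (j : Fin k) :
    u (realPoint f + c • column R j) = u (realPoint f) + c * u.linear (column R j) := by
  rw [add_comm, ← vadd_eq_add, u.map_vadd, vadd_eq_add, add_comm]
  simp

/-- A functional that is nonnegative on the induced set decreases along a column at a rate of at
most `α j` times its value at `f`. -/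
theorem neg_mul_le_linear_column {u : (Fin 2 → ℝ) →ᵃ[ℝ] ℝ} (hα : ∀ j, 0 ≤ α j)
    (hu : ∀ y ∈ inducedSet R f α, 0 ≤ u y) (j : Fin k) :
    -(α j * u (realPoint f)) ≤ u.linear (column R j) := by
  rcases (hα j).lt_or_eq with hj | hj
  · have := hu _ (add_inv_smul_column_mem_inducedSet (R := R) (f := f) hj)
    rw [map_add_smul_column] at this
    have h2 := mul_nonneg hj.le this
    rw [mul_add, ← mul_assoc, mul_inv_cancel₀ hj.ne', one_mul] at h2
    linarith
  · rw [← hj]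
    by_contra! hneg
    simp only [zero_mul, neg_zero] at hneg
    have hf := hu _ (realPoint_mem_inducedSet (R := R) (f := f) (α := α))
    -- Moving this far along the ray would bring `u` down to `-1`.
    have hc : 0 ≤ (u (realPoint f) + 1) / -u.linear (column R j) :=
      div_nonneg (by linarith) (by linarith)
    have := hu _ (add_smul_column_mem_inducedSet (R := R) (f := f) hj.symm hc)
    rw [map_add_smul_column, div_mul_eq_mul_div, div_neg, mul_div_cancel_right₀ _ hneg.ne] at this
    linarith

/-- A side of the induced set gives a lower bound for the cost `∑ j, α j * s j`. -/
theorem one_sub_le_cost {u : (Fin 2 → ℝ) →ᵃ[ℝ] ℝ} (hα : ∀ j, 0 ≤ α j)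
    (hu : ∀ y ∈ inducedSet R f α, 0 ≤ u y) (hf : 0 < u (realPoint f))
    {z : (Fin 2 → ℝ) × (Fin k → ℝ)} (hz : z ∈ relaxation R f) :
    1 - (u (realPoint f))⁻¹ * u z.1 ≤ ∑ j, α j * z.2 j := by
  have hx : z.1 = realPoint f + ∑ j, z.2 j • column R j := by
    ext i
    rw [← hz.1 i]
    simp [realPoint, column, mul_comm]
  have h : -(u (realPoint f) * ∑ j, α j * z.2 j) ≤ ∑ j, z.2 j * u.linear (column R j) := by
    rw [Finset.mul_sum, ← Finset.sum_neg_distrib]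
    refine Finset.sum_le_sum fun j _ => ?_
    have := mul_le_mul_of_nonneg_left (neg_mul_le_linear_column hα hu j) (hz.2 j)
    linarith
  have e : u z.1 = u (realPoint f) + ∑ j, z.2 j * u.linear (column R j) := by
    rw [hx, map_add_sum_columns]
  have h2 : u (realPoint f) * (1 - ∑ j, α j * z.2 j) ≤ u z.1 := by linarith
  have h3 := mul_le_mul_of_nonneg_left h2 (inv_pos.2 hf).le
  rw [← mul_assoc, inv_mul_cancel₀ hf.ne', one_mul] at h3
  linarith

/-- The end of a ray of the induced set lies on two sides that meet in a point of the set. -/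
theorem exists_column_of_mem_sides {u w : (Fin 2 → ℝ) →ᵃ[ℝ] ℝ} (hα : ∀ j, 0 ≤ α j)
    (hu : ∀ y ∈ inducedSet R f α, 0 ≤ u y) (hw : ∀ y ∈ inducedSet R f α, 0 ≤ w y)
    (hf : 0 < u (realPoint f)) {y : Fin 2 → ℝ} (hy : y ∈ inducedSet R f α)
    (huy : u y = 0) (hwy : w y = 0) :
    ∃ j, 0 < α j ∧ u (realPoint f + (α j)⁻¹ • column R j) = 0 ∧
      w (realPoint f + (α j)⁻¹ • column R j) = 0 := by
  have hwf := hw _ (realPoint_mem_inducedSet (R := R) (f := f) (α := α))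
  have hg : ∀ y ∈ inducedSet R f α, 0 ≤ (u + w) y := fun y hy => add_nonneg (hu y hy) (hw y hy)
  obtain ⟨s, hs, hs1, rfl⟩ := exists_cost_le_one_of_mem_inducedSet hα hy
  have hgf : 0 < (u + w) (realPoint f) := add_pos_of_pos_of_nonneg hf hwf
  have e : (u + w) (realPoint f) + ∑ j, s j * (u + w).linear (column R j) = 0 := by
    rw [← map_add_sum_columns]
    exact (congrArg₂ (· + ·) huy hwy).trans (add_zero 0)
  -- These nonnegative terms sum to `(u + w) f` times (cost `- 1`), which is `≤ 0`. Hence all vanish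
  -- and the cost is exactly `1`, so some column with `α j * s j ≠ 0` ends where `u + w = 0`.
  have hterm : ∀ j, 0 ≤ s j * ((u + w).linear (column R j) + α j * (u + w) (realPoint f)) :=
    fun j => mul_nonneg (hs j) (by linarith [neg_mul_le_linear_column hα hg j])
  have hsum : ∑ j, s j * ((u + w).linear (column R j) + α j * (u + w) (realPoint f)) =
      (u + w) (realPoint f) * (∑ j, α j * s j - 1) := by
    rw [mul_sub, mul_one, Finset.mul_sum]
    simp only [mul_add, Finset.sum_add_distrib]
    rw [eq_sub_of_add_eq' e]
    simp only [zero_sub, neg_add_eq_sub]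
    congr 1
    exact Finset.sum_congr rfl fun j _ => by ring
  have hle : (u + w) (realPoint f) * (∑ j, α j * s j - 1) ≤ 0 :=
    mul_nonpos_of_nonneg_of_nonpos hgf.le (by linarith)
  have hz : ∑ j, s j * ((u + w).linear (column R j) + α j * (u + w) (realPoint f)) = 0 :=
    le_antisymm (hsum.trans_le hle) (Finset.sum_nonneg fun j _ => hterm j)
  have hcost : ∑ j, α j * s j = 1 := by
    rw [hsum, mul_eq_zero] at hz
    rcases hz with h | h
    · exact absurd h hgf.ne'
    · linarith
  obtain ⟨j, -, hj⟩ : ∃ j ∈ Finset.univ, α j * s j ≠ 0 := by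
    apply Finset.exists_ne_zero_of_sum_ne_zero
    rw [hcost]; exact one_ne_zero
  have hαj : 0 < α j := lt_of_le_of_ne (hα j) fun h => hj (by rw [← h, zero_mul])
  have hsj : s j ≠ 0 := fun h => hj (by rw [h, mul_zero])
  have hlin : (u + w).linear (column R j) + α j * (u + w) (realPoint f) = 0 := by
    have := (Finset.sum_eq_zero_iff_of_nonneg fun j _ => hterm j).1 hz j (Finset.mem_univ j)
    exact (mul_eq_zero.1 this).resolve_left hsj
  have hmem := add_inv_smul_column_mem_inducedSet (R := R) (f := f) hαj
  have hval : u (realPoint f + (α j)⁻¹ • column R j) + w (realPoint f + (α j)⁻¹ • column R j) = 0 := by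
    have h1 : (u + w) (realPoint f + (α j)⁻¹ • column R j) = 0 := by
      rw [map_add_smul_column, eq_neg_of_add_eq_zero_left hlin]
      field_simp
      ring
    exact h1
  have hu' := hu _ hmem
  have hw' := hw _ hmem
  exact ⟨j, hαj, by linarith, by linarith⟩

/-- If the inequality `∑ j, α j * s j ≥ 1` is valid, then `f` does not lie on a segment of the
induced set with an integer point in its relative interior. -/
theorem realPoint_notMem_segment (hf : realPoint f ∉ integerPoints 2) (hα : ∀ j, 0 ≤ α j)
    (hvalid : IsValidIneq (convexHull ℝ (mixedIntegerSet R f)) 0 (-α) (-1))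
    {u w p : Fin 2 → ℝ} (hu : u ∈ inducedSet R f α) (hw : w ∈ inducedSet R f α)
    (hp : p ∈ openSegment ℝ u w) (hpi : p ∈ integerPoints 2) :
    realPoint f ∉ segment ℝ u w := by
  intro hfs
  have key : ∀ y ∈ inducedSet R f α, ∀ t : ℝ, 0 ≤ t → t < 1 →
      -- Such a `p` is reached at cost at most `t < 1`, against validity.
      p = realPoint f + t • (y - realPoint f) → False := by
    intro y hy t ht ht1 hpt
    obtain ⟨s, hs, hs1, rfl⟩ := exists_cost_le_one_of_mem_inducedSet hα hy
    have hmem : (p, t • s) ∈ mixedIntegerSet R f := by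
      refine ⟨⟨fun i => ?_, fun j => mul_nonneg ht (hs j)⟩, hpi⟩
      have := congrFun hpt i
      simp only [add_sub_cancel_left, Pi.add_apply, Pi.smul_apply, smul_eq_mul,
        Finset.sum_apply] at this
      refine Eq.trans ?_ this.symm
      rw [Finset.mul_sum]
      exact congrArg _ (Finset.sum_congr rfl fun j _ => by
        simp only [column, Pi.smul_apply, smul_eq_mul]
        ring)
    have := hvalid _ (subset_convexHull ℝ _ hmem)
    simp only [Pi.zero_apply, zero_mul, Finset.sum_const_zero, zero_add, Pi.neg_apply,
      Pi.smul_apply, smul_eq_mul, neg_mul, Finset.sum_neg_distrib, neg_le_neg_iff] at this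
    have e : ∑ j, α j * (t * s j) = t * ∑ j, α j * s j := by
      rw [Finset.mul_sum]
      exact Finset.sum_congr rfl fun j _ => by ring
    rw [e] at this
    have : t * ∑ j, α j * s j ≤ t * 1 := mul_le_mul_of_nonneg_left hs1 ht
    linarith
  rw [openSegment_eq_image'] at hp
  rw [segment_eq_image'] at hfs
  obtain ⟨t, ⟨ht0, ht1⟩, hpt⟩ := hp
  obtain ⟨r, ⟨hr0, hr1⟩, hfr⟩ := hfs
  simp only at hpt hfr
  -- `p` lies between `f` and one end of the segment, strictly before that end, unless `p = f`.
  rcases lt_trichotomy t r with h | h | h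
  · have hr : 0 < r := by linarith
    refine key u hu (1 - t / r) ?_ ?_ ?_
    · rw [sub_nonneg, div_le_one hr]; exact h.le
    · have := div_pos ht0 hr; linarith
    · rw [← hpt, ← hfr]
      ext i
      simp only [Pi.add_apply, Pi.smul_apply, smul_eq_mul, Pi.sub_apply]
      field_simp
      ring
  · apply hf
    rw [← hfr, ← h, hpt]
    exact hpi
  · have hr : 0 < 1 - r := by linarith
    refine key w hw ((t - r) / (1 - r)) ?_ ?_ ?_
    · exact div_nonneg (by linarith) hr.le
    · rw [div_lt_one hr]; linarith
    · rw [← hpt, ← hfr]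
      ext i
      simp only [Pi.add_apply, Pi.smul_apply, smul_eq_mul, Pi.sub_apply]
      field_simp
      ring

end InducedSet

/-! ### Barycentric coordinates in a triangle -/

theorem add_smul_mem_convexHull_triple {E : Type*} [AddCommGroup E] [Module ℝ E] (p q r : E)
    {x y z : ℝ} (hx : 0 ≤ x) (hy : 0 ≤ y) (hz : 0 ≤ z) (h : x + y + z = 1) :
    x • p + y • q + z • r ∈ convexHull ℝ {p, q, r} := by
  have := (convex_convexHull ℝ ({p, q, r} : Set E)).sum_mem (t := Finset.univ) (w := ![x, y, z])
    (z := ![p, q, r]) (by intro i _; fin_cases i <;> simpa) (by simpa [Fin.sum_univ_three] using h)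
    (by intro i _; apply subset_convexHull; fin_cases i <;> simp)
  simpa [Fin.sum_univ_three] using this

theorem exists_of_mem_convexHull_triple {E : Type*} [AddCommGroup E] [Module ℝ E] {p q r f : E}
    (hf : f ∈ convexHull ℝ {p, q, r}) :
    ∃ x y z : ℝ, 0 ≤ x ∧ 0 ≤ y ∧ 0 ≤ z ∧ x + y + z = 1 ∧ f = x • p + y • q + z • r := by
  rw [convexHull_insert (by simp), convexHull_pair, mem_convexJoin] at hf
  obtain ⟨p', hp', g, ⟨y, z, hy, hz, hyz, rfl⟩, ⟨x, w, hx, hw, hxw, rfl⟩⟩ := hf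
  rw [Set.mem_singleton_iff] at hp'
  subst hp'
  refine ⟨x, w * y, w * z, hx, mul_nonneg hw hy, mul_nonneg hw hz, ?_, ?_⟩
  · rw [add_assoc, ← mul_add, hyz, mul_one, hxw]
  · rw [smul_add, smul_smul, smul_smul, add_assoc]

theorem affineMap_add_smul_triple {E : Type*} [AddCommGroup E] [Module ℝ E] (u : E →ᵃ[ℝ] ℝ)
    (p q r : E) {x y z : ℝ} (h : x + y + z = 1) :
    u (x • p + y • q + z • r) = x * u p + y * u q + z * u r := by
  have hu : ∀ e, u e = u.linear e + u 0 := fun e => by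
    simpa using u.map_vadd 0 e
  rw [hu, hu p, hu q, hu r]
  simp only [map_add, map_smul, smul_eq_mul]
  linear_combination (-u 0) * h

/-- An affine functional that vanishes at two vertices of a triangle and is positive at the third
is nonnegative on the triangle, and positive off the side where it vanishes. -/
theorem nonneg_and_pos_of_side {E : Type*} [AddCommGroup E] [Module ℝ E] (u : E →ᵃ[ℝ] ℝ)
    {p q r : E} (hp : u p = 0) (hq : u q = 0) (hr : 0 < u r) {f : E}
    (hf : f ∈ convexHull ℝ {p, q, r}) : 0 ≤ u f ∧ (f ∉ segment ℝ p q → 0 < u f) := by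
  obtain ⟨x, y, z, hx, hy, hz, h, rfl⟩ := exists_of_mem_convexHull_triple hf
  rw [affineMap_add_smul_triple u p q r h, hp, hq, mul_zero, mul_zero, zero_add, zero_add]
  refine ⟨mul_nonneg hz hr.le, fun hs => mul_pos (lt_of_le_of_ne hz fun hz0 => hs ?_) hr⟩
  rw [← hz0] at h ⊢
  exact ⟨x, y, hx, hy, by simpa using h, by simp⟩

/-! ### Unimodular coordinates -/

/-- Unimodular integer coordinates in which the side `[a, b]` of a triangle, known to contain two
integer points, is horizontal at height `0` and contains `(0, 0)` and `(1, 0)`. -/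
theorem exists_unimodular_coordinates {v a b : Fin 2 → ℝ} (hT : AffineIndependent ℝ ![v, a, b])
    (hab : (segment ℝ a b ∩ integerPoints 2).Nontrivial) :
    ∃ A B c C D d : ℤ, (A * D - B * C) * (A * D - B * C) = 1 ∧
      planeAffine C D d a = 0 ∧ planeAffine C D d b = 0 ∧ 0 < planeAffine C D d v ∧
      planeAffine A B c a ≤ 0 ∧ 1 ≤ planeAffine A B c b := by
  obtain ⟨t, t', z, z', htt, ht0, ht1, hz, hz', hzi, hzi'⟩ : ∃ (t t' : ℝ) (z z' : Fin 2 → ℝ),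
      t < t' ∧ 0 ≤ t ∧ t' ≤ 1 ∧ a + t • (b - a) = z ∧ a + t' • (b - a) = z' ∧
      z ∈ integerPoints 2 ∧ z' ∈ integerPoints 2 := by
    obtain ⟨z, ⟨hzs, hzi⟩, z', ⟨hzs', hzi'⟩, hne⟩ := hab
    rw [segment_eq_image'] at hzs hzs'
    obtain ⟨t, ⟨ht0, ht1⟩, hz⟩ := hzs
    obtain ⟨t', ⟨ht0', ht1'⟩, hz'⟩ := hzs'
    rcases lt_trichotomy t t' with h | h | h
    · exact ⟨t, t', z, z', h, ht0, ht1', hz, hz', hzi, hzi'⟩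
    · subst h; exact absurd (hz.symm.trans hz') hne
    · exact ⟨t', t, z', z, h, ht0', ht1, hz', hz, hzi', hzi⟩
  choose n hn using hzi
  choose n' hn' using hzi'
  have hpos : 0 < t' - t := by linarith
  have h0 := congrFun hz 0
  have h1 := congrFun hz 1
  have h0' := congrFun hz' 0
  have h1' := congrFun hz' 1
  simp only [Pi.add_apply, Pi.smul_apply, Pi.sub_apply, smul_eq_mul, hn, hn'] at h0 h1 h0' h1'
  have hd : n' 0 - n 0 ≠ 0 ∨ n' 1 - n 1 ≠ 0 := by
    by_contra! hcon
    have e0 : (n' 0 : ℝ) = n 0 := by exact_mod_cast sub_eq_zero.1 hcon.1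
    have e1 : (n' 1 : ℝ) = n 1 := by exact_mod_cast sub_eq_zero.1 hcon.2
    have e0' : b 0 = a 0 := by
      have : (t' - t) * (b 0 - a 0) = 0 := by linarith
      linarith [(mul_eq_zero.1 this).resolve_left hpos.ne']
    have e1' : b 1 = a 1 := by
      have : (t' - t) * (b 1 - a 1) = 0 := by linarith
      linarith [(mul_eq_zero.1 this).resolve_left hpos.ne']
    have hba : b = a := by ext i; fin_cases i <;> assumption
    have := hT.injective.ne (show (1 : Fin 3) ≠ 2 by decide)
    exact this (by simpa using hba.symm)
  obtain ⟨g, e₀, e₁, hg, hcop, hge₀, hge₁⟩ : ∃ g e₀ e₁ : ℤ, 0 < g ∧ IsCoprime e₀ e₁ ∧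
      n' 0 - n 0 = e₀ * g ∧ n' 1 - n 1 = e₁ * g := by
    have hgpos : 0 < Int.gcd (n' 0 - n 0) (n' 1 - n 1) := Int.gcd_pos_iff.2 hd
    obtain ⟨e₀, e₁, h, h1, h2⟩ := Int.exists_gcd_one hgpos
    exact ⟨_, e₀, e₁, by exact_mod_cast hgpos, Int.isCoprime_iff_gcd_eq_one.2 h, h1, h2⟩
  -- Bézout coefficients complete the primitive direction of the base to a unimodular system.
  obtain ⟨s, r, hsr⟩ := hcop
  have hgr : (1 : ℝ) ≤ g := by exact_mod_cast hg
  have hsr' : (s : ℝ) * e₀ + r * e₁ = 1 := by exact_mod_cast hsr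
  have d0 : (t' - t) * (b 0 - a 0) = e₀ * g := by
    have : ((n' 0 - n 0 : ℤ) : ℝ) = e₀ * g := by exact_mod_cast hge₀
    push_cast at this; linarith
  have d1 : (t' - t) * (b 1 - a 1) = e₁ * g := by
    have : ((n' 1 - n 1 : ℤ) : ℝ) = e₁ * g := by exact_mod_cast hge₁
    push_cast at this; linarith
  have hcross : e₀ * (b 1 - a 1) = e₁ * (b 0 - a 0) := by
    apply mul_left_cancel₀ hpos.ne'
    linear_combination (e₀ : ℝ) * d1 - (e₁ : ℝ) * d0
  have hX : (t' - t) * (s * (b 0 - a 0) + r * (b 1 - a 1)) = g := by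
    linear_combination (s : ℝ) * d0 + (r : ℝ) * d1 + (g : ℝ) * hsr'
  have hXpos : 0 < s * (b 0 - a 0) + r * (b 1 - a 1) :=
    (pos_iff_pos_of_mul_pos (by rw [hX]; linarith)).1 hpos
  have hv0 : -(e₁ : ℝ) * (v 0 - n 0) + e₀ * (v 1 - n 1) ≠ 0 := by
    intro hv
    rw [affineIndependent_iff_not_collinear_set] at hT
    apply hT
    rw [collinear_iff_of_mem (p₀ := a) (by simp)]
    refine ⟨b - a, ?_⟩
    simp only [Set.mem_insert_iff, Set.mem_singleton_iff, forall_eq_or_imp, forall_eq]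
    have hcv : (e₀ : ℝ) * (v 1 - a 1) = e₁ * (v 0 - a 0) := by
      linear_combination hv - (e₀ : ℝ) * h1 + (e₁ : ℝ) * h0 + t * hcross
    refine ⟨⟨(s * (v 0 - a 0) + r * (v 1 - a 1)) / (s * (b 0 - a 0) + r * (b 1 - a 1)), ?_⟩,
      ⟨0, by simp⟩, ⟨1, by simp⟩⟩
    set Xb := s * (b 0 - a 0) + r * (b 1 - a 1) with hXb
    have eb0 : b 0 - a 0 = e₀ * Xb := by
      rw [hXb]; linear_combination (-(b 0 - a 0)) * hsr' - (r : ℝ) * hcross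
    have eb1 : b 1 - a 1 = e₁ * Xb := by
      rw [hXb]; linear_combination (-(b 1 - a 1)) * hsr' + (s : ℝ) * hcross
    ext i
    fin_cases i
    · simp only [Fin.zero_eta, vadd_eq_add, Pi.add_apply, Pi.smul_apply, Pi.sub_apply, smul_eq_mul]
      rw [eb0]
      field_simp
      linear_combination (-(v 0 - a 0)) * hsr' - (r : ℝ) * hcv
    · simp only [Fin.mk_one, vadd_eq_add, Pi.add_apply, Pi.smul_apply, Pi.sub_apply, smul_eq_mul]
      rw [eb1]
      field_simp
      linear_combination (-(v 1 - a 1)) * hsr' + (s : ℝ) * hcv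
  obtain ⟨τ, hττ, hτ⟩ : ∃ τ : ℤ, τ * τ = 1 ∧
      0 < (τ : ℝ) * (-(e₁ : ℝ) * (v 0 - n 0) + e₀ * (v 1 - n 1)) := by
    rcases hv0.lt_or_gt with h | h
    · exact ⟨-1, by norm_num, by push_cast; linarith⟩
    · exact ⟨1, by norm_num, by push_cast; linarith⟩
  -- The origin is the first integer point on the base; the second is `(g, 0)` with `g ≥ 1`. The
  -- sign `τ` puts `v` above the base.
  refine ⟨s, r, -(s * n 0 + r * n 1), -τ * e₁, τ * e₀, τ * (e₁ * n 0 - e₀ * n 1),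
    ?_, ?_, ?_, ?_, ?_, ?_⟩
  · linear_combination (s * e₀ + r * e₁ + 1) * τ * τ * hsr + hττ
  all_goals simp only [planeAffine_apply]
  all_goals push_cast
  · linear_combination -(τ : ℝ) * (e₁ * h0 - e₀ * h1 + t * hcross)
  · linear_combination -(τ : ℝ) * (e₁ * h0 - e₀ * h1 + (t - 1) * hcross)
  · linarith
  · have := mul_nonneg ht0 hXpos.le
    linear_combination this + (s : ℝ) * h0 + (r : ℝ) * h1
  · have := mul_nonneg (sub_nonneg.2 ht1) hXpos.le
    linear_combination this + hgr - (s : ℝ) * h0 - (r : ℝ) * h1 - hX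

section Coordinates

variable {A B c C D d : ℤ}

theorem eq_of_coordinates (hdet : (A * D - B * C) * (A * D - B * C) = 1) {x y : Fin 2 → ℝ}
    (hX : planeAffine A B c x = planeAffine A B c y)
    (hY : planeAffine C D d x = planeAffine C D d y) : x = y := by
  simp only [planeAffine_apply] at hX hY
  have hr : ((A : ℝ) * D - B * C) * (A * D - B * C) = 1 := by exact_mod_cast hdet
  ext i
  fin_cases i
  · simp only [Fin.zero_eta]
    linear_combination (A * D - B * C : ℝ) * (D * hX - B * hY) - (x 0 - y 0) * hr
  · simp only [Fin.mk_one]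
    linear_combination (A * D - B * C : ℝ) * (A * hY - C * hX) - (x 1 - y 1) * hr

theorem exists_integerPoint_of_coordinates (hdet : (A * D - B * C) * (A * D - B * C) = 1)
    (m n : ℤ) :
    ∃ x ∈ integerPoints 2, planeAffine A B c x = m ∧ planeAffine C D d x = n := by
  have hr : ((A : ℝ) * D - B * C) * (A * D - B * C) = 1 := by exact_mod_cast hdet
  refine ⟨![((A * D - B * C) * (D * (m - c) - B * (n - d)) : ℤ),
    ((A * D - B * C) * (A * (n - d) - C * (m - c)) : ℤ)], ?_, ?_, ?_⟩
  · intro i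
    fin_cases i
    · exact ⟨_, rfl⟩
    · exact ⟨_, rfl⟩
  · simp only [planeAffine_apply, Matrix.cons_val_zero, Matrix.cons_val_one]
    push_cast
    linear_combination ((m : ℝ) - c) * hr
  · simp only [planeAffine_apply, Matrix.cons_val_zero, Matrix.cons_val_one]
    push_cast
    linear_combination ((n : ℝ) - d) * hr

theorem exists_int_coordinate (A B c : ℤ) {x : Fin 2 → ℝ} (hx : x ∈ integerPoints 2) :
    ∃ m : ℤ, planeAffine A B c x = m := by
  obtain ⟨p, hp⟩ := hx 0
  obtain ⟨q, hq⟩ := hx 1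
  exact ⟨A * p + B * q + c, by simp only [planeAffine_apply, hp, hq]; push_cast; ring⟩

/-- Hypothesis `h` is the line through `v` and `a` in cross-multiplied form; the ratio of heights is
then the weight of `v`. -/
theorem mem_openSegment_of_coordinates (hdet : (A * D - B * C) * (A * D - B * C) = 1)
    {v a x : Fin 2 → ℝ} (ha : planeAffine C D d a = 0) (h0 : 0 < planeAffine C D d x)
    (h1 : planeAffine C D d x < planeAffine C D d v)
    (h : planeAffine C D d v * (planeAffine A B c x - planeAffine A B c a) =
      (planeAffine A B c v - planeAffine A B c a) * planeAffine C D d x) :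
    x ∈ openSegment ℝ v a := by
  have hv : 0 < planeAffine C D d v := h0.trans h1
  set t := planeAffine C D d x / planeAffine C D d v with ht
  have ht1 : t < 1 := (div_lt_one hv).2 h1
  have htv : t * planeAffine C D d v = planeAffine C D d x := div_mul_cancel₀ _ hv.ne'
  refine ⟨t, 1 - t, div_pos h0 hv, by linarith, by ring, ?_⟩
  have key := fun u : (Fin 2 → ℝ) →ᵃ[ℝ] ℝ =>
    affineMap_add_smul_triple u v a a (x := t) (y := 1 - t) (z := 0) (by ring)
  simp only [zero_smul, add_zero, zero_mul] at key
  apply eq_of_coordinates (c := c) (d := d) hdet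
  · rw [key]
    apply mul_left_cancel₀ hv.ne'
    linear_combination (planeAffine A B c v - planeAffine A B c a) * htv - h
  · rw [key, ha, htv]; ring

/-- The unique integer point in an open side, in coordinates. -/
theorem side_integerPoint_coordinates (hdet : (A * D - B * C) * (A * D - B * C) = 1)
    {v a : Fin 2 → ℝ} (ha : planeAffine C D d a = 0) (hv : 0 < planeAffine C D d v)
    (hp : ∃! p, p ∈ openSegment ℝ v a ∩ integerPoints 2) :
    (∃ m n : ℤ, (0 : ℝ) < n ∧ n < planeAffine C D d v ∧
      planeAffine C D d v * (m - planeAffine A B c a) =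
        (planeAffine A B c v - planeAffine A B c a) * n) ∧
    ∀ m n m' n' : ℤ, (0 : ℝ) < n → n < planeAffine C D d v →
      planeAffine C D d v * (m - planeAffine A B c a) =
        (planeAffine A B c v - planeAffine A B c a) * n →
      (0 : ℝ) < n' → n' < planeAffine C D d v →
      planeAffine C D d v * (m' - planeAffine A B c a) =
        (planeAffine A B c v - planeAffine A B c a) * n' → n = n' := by
  constructor
  · obtain ⟨p, ⟨⟨s, t, hs, ht, hst, hpe⟩, hpi⟩, -⟩ := hp
    obtain ⟨m, hm⟩ := exists_int_coordinate A B c hpi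
    obtain ⟨n, hn⟩ := exists_int_coordinate C D d hpi
    have key := fun u : (Fin 2 → ℝ) →ᵃ[ℝ] ℝ =>
      affineMap_add_smul_triple u v a a (x := s) (y := t) (z := 0) (by linarith)
    simp only [zero_smul, add_zero, zero_mul, hpe] at key
    have k1 := key (planeAffine A B c)
    have k2 := key (planeAffine C D d)
    rw [ha, hn, mul_zero, add_zero] at k2
    rw [hm] at k1
    refine ⟨m, n, by rw [k2]; positivity, ?_, ?_⟩
    · rw [k2]
      have := mul_pos ht hv
      have : (s + t) * planeAffine C D d v = planeAffine C D d v := by rw [hst, one_mul]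
      linarith
    · rw [k1, k2]
      linear_combination planeAffine C D d v * planeAffine A B c a * hst
  · intro m n m' n' h1 h2 h3 h1' h2' h3'
    obtain ⟨x, hxi, hx1, hx2⟩ := exists_integerPoint_of_coordinates (c := c) (d := d) hdet m n
    obtain ⟨y, hyi, hy1, hy2⟩ := exists_integerPoint_of_coordinates (c := c) (d := d) hdet m' n'
    have hxm := mem_openSegment_of_coordinates (c := c) hdet ha (x := x) (v := v)
      (by rwa [hx2]) (by rwa [hx2]) (by rwa [hx1, hx2])
    have hym := mem_openSegment_of_coordinates (c := c) hdet ha (x := y) (v := v)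
      (by rwa [hy2]) (by rwa [hy2]) (by rwa [hy1, hy2])
    have hxy := hp.unique ⟨hxm, hxi⟩ ⟨hym, hyi⟩
    have : (n : ℝ) = n' := by rw [← hx2, ← hy2, hxy]
    exact_mod_cast this

/-- Points that lie strictly inside the three sides, in coordinates, are interior points. -/
theorem mem_interior_of_coordinates (hdet : (A * D - B * C) * (A * D - B * C) = 1)
    {v a b x : Fin 2 → ℝ} (ha : planeAffine C D d a = 0) (hb : planeAffine C D d b = 0)
    (hv : 0 < planeAffine C D d v) (hab : planeAffine A B c a < planeAffine A B c b)
    (h0 : 0 < planeAffine C D d x)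
    (h1 : 0 < planeAffine C D d v * (planeAffine A B c x - planeAffine A B c a) -
      (planeAffine A B c v - planeAffine A B c a) * planeAffine C D d x)
    (h2 : 0 < planeAffine C D d v * (planeAffine A B c b - planeAffine A B c x) -
      (planeAffine A B c b - planeAffine A B c v) * planeAffine C D d x) :
    x ∈ interior (convexHull ℝ {v, a, b}) := by
  set X := planeAffine A B c with hX
  set Y := planeAffine C D d with hY
  have hXc : Continuous X := by
    have : (X : (Fin 2 → ℝ) → ℝ) = fun x : Fin 2 → ℝ => A * x 0 + B * x 1 + c := by ext; simp [hX]
    rw [this]; fun_prop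
  have hYc : Continuous Y := by
    have : (Y : (Fin 2 → ℝ) → ℝ) = fun x : Fin 2 → ℝ => C * x 0 + D * x 1 + d := by ext; simp [hY]
    rw [this]; fun_prop
  rw [mem_interior]
  refine ⟨{x | 0 < Y x ∧ 0 < Y v * (X x - X a) - (X v - X a) * Y x ∧
    0 < Y v * (X b - X x) - (X b - X v) * Y x}, ?_, ?_, ⟨h0, h1, h2⟩⟩
  · rintro y ⟨g0, g1, g2⟩
    have hs : 0 < Y v * (X b - X a) := mul_pos hv (sub_pos.2 hab)
    -- Up to positive factors the three strict inequalities are the barycentric weights of `v`, `b`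
    -- and `a`.
    have hsum : Y y / Y v + (Y v * (X b - X y) - (X b - X v) * Y y) / (Y v * (X b - X a)) +
        (Y v * (X y - X a) - (X v - X a) * Y y) / (Y v * (X b - X a)) = 1 := by
      have := sub_pos.2 hab
      field_simp
      ring
    have hmem := add_smul_mem_convexHull_triple v a b (div_pos g0 hv).le (div_pos g2 hs).le
      (div_pos g1 hs).le hsum
    convert hmem using 1
    apply eq_of_coordinates (c := c) (d := d) hdet
    · change X _ = X _
      have := sub_pos.2 hab
      rw [affineMap_add_smul_triple X v a b hsum]
      field_simp
      ring
    · change Y _ = Y _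
      rw [affineMap_add_smul_triple Y v a b hsum, ha, hb]
      field_simp
      ring
  · exact (isOpen_lt continuous_const hYc).inter
      ((isOpen_lt continuous_const
        ((continuous_const.mul (hXc.sub continuous_const)).sub (continuous_const.mul hYc))).inter
      (isOpen_lt continuous_const
        ((continuous_const.mul (continuous_const.sub hXc)).sub (continuous_const.mul hYc))))

end Coordinates

/-! ### Coordinates adapted to the triangle, and rationality -/

/-- Integer coordinates in which a triangle of type `T^{2A}` has its base on the line at height
`0`, with `(0, 0)` and `(1, 0)` in the relative interior, and its other sides go through `(0, 1)`
and `(1, 1)`. -/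
theorem exists_coordinates_of_isTriangleT2A {T : Set (Fin 2 → ℝ)} (hT : IsTriangleT2A T) :
    ∃ (v a b : Fin 2 → ℝ) (A B c C D d : ℤ), T = convexHull ℝ {v, a, b} ∧
      planeAffine C D d a = 0 ∧ planeAffine C D d b = 0 ∧ 1 < planeAffine C D d v ∧
      planeAffine A B c a < 0 ∧ 1 < planeAffine A B c b ∧
      planeAffine A B c v = planeAffine A B c a * (1 - planeAffine C D d v) ∧
      1 - planeAffine A B c v = (1 - planeAffine A B c b) * (1 - planeAffine C D d v) ∧
      (openSegment ℝ v a ∩ integerPoints 2).Nonempty ∧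
      (openSegment ℝ v b ∩ integerPoints 2).Nonempty ∧
      (openSegment ℝ a b ∩ integerPoints 2).Nonempty := by
  obtain ⟨hfree, v, a, b, hind, rfl, hvi, hab, hp, hq⟩ := hT
  obtain ⟨A, B, c, C, D, d, hdet, ha, hb, hv, hXa, hXb⟩ := exists_unimodular_coordinates hind hab
  obtain ⟨hp1, hp2⟩ := side_integerPoint_coordinates (c := c) hdet ha hv hp
  obtain ⟨hq1, hq2⟩ := side_integerPoint_coordinates (c := c) hdet hb hv hq
  have flip : ∀ m n : ℤ, planeAffine C D d v * (planeAffine A B c b - m) =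
      (planeAffine A B c b - planeAffine A B c v) * n → planeAffine C D d v *
      (m - planeAffine A B c b) = (planeAffine A B c v - planeAffine A B c b) * n :=
    fun m n h => by linarith
  obtain ⟨n, m, h1, h2, h3, h4, h5⟩ := exists_int_normal_form hv hXa hXb
    (by
      intro m n h0 h1 h2
      obtain ⟨x, hxi, hx1, hx2⟩ := exists_integerPoint_of_coordinates (c := c) (d := d) hdet m n
      have := mem_interior_of_coordinates hdet ha hb hv (by linarith) (x := x)
        (by rwa [hx2]) (by rwa [hx1, hx2]) (by rwa [hx1, hx2])
      exact (Set.eq_empty_iff_forall_notMem.1 hfree x) ⟨this, hxi⟩)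
    (by
      intro m n h1 h2
      obtain ⟨x, hxi, hx1, hx2⟩ := exists_integerPoint_of_coordinates (c := c) (d := d) hdet m n
      exact hvi (eq_of_coordinates (c := c) (d := d) hdet (h1.trans hx1.symm)
        (h2.trans hx2.symm) ▸ hxi))
    hp1 hp2 (by
      obtain ⟨m, n, h1, h2, h3⟩ := hq1
      exact ⟨m, n, h1, h2, by linarith⟩)
    (fun m n m' n' h1 h2 h3 h1' h2' h3' =>
      hq2 m n m' n' h1 h2 (flip _ _ h3) h1' h2' (flip _ _ h3'))
  -- An integral shear and translation takes `(n, 0)` and `(m, 1)` to `(0, 0)` and `(0, 1)`.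
  have hX : ∀ x, planeAffine ((A - (m - n) * C : ℤ) : ℝ) ((B - (m - n) * D : ℤ) : ℝ)
      ((c - n - (m - n) * d : ℤ) : ℝ) x =
      planeAffine A B c x - n - (m - n) * planeAffine C D d x := by
    intro x
    simp only [planeAffine_apply]
    push_cast
    ring
  refine ⟨v, a, b, A - (m - n) * C, B - (m - n) * D, c - n - (m - n) * d, C, D, d, rfl, ha, hb,
    h3, ?_, ?_, ?_, ?_, hp.exists, hq.exists, ?_⟩
  · rw [hX, ha]; linarith
  · rw [hX, hb]; linarith
  · rw [hX, hX, ha]; linear_combination -h4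
  · rw [hX, hX, hb]; linear_combination -h5
  · obtain ⟨x, hxi, hx1, hx2⟩ := exists_integerPoint_of_coordinates (c := c) (d := d) hdet n 0
    refine ⟨x, ?_, hxi⟩
    have hlen : 0 < planeAffine A B c b - planeAffine A B c a := by linarith
    set t := (n - planeAffine A B c a) / (planeAffine A B c b - planeAffine A B c a) with ht
    have ht0 : 0 < t := div_pos (by linarith) hlen
    have ht1 : t < 1 := (div_lt_one hlen).2 (by linarith)
    have htn : t * (planeAffine A B c b - planeAffine A B c a) = n - planeAffine A B c a :=
      div_mul_cancel₀ _ hlen.ne'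
    refine ⟨1 - t, t, by linarith, ht0, by ring, ?_⟩
    have key := fun u : (Fin 2 → ℝ) →ᵃ[ℝ] ℝ =>
      affineMap_add_smul_triple u a b b (x := 1 - t) (y := t) (z := 0) (by ring)
    simp only [zero_smul, add_zero, zero_mul] at key
    apply eq_of_coordinates (c := c) (d := d) hdet
    · rw [key, hx1]; linear_combination htn
    · rw [key, ha, hb, hx2]; simp

/-- If a rational ray from `f` meets the line `Y = 0`, for integer functionals `X` and `Y` with
`Y f ≠ 0`, then `X` is rational at the intersection. -/
theorem exists_rat_of_rational_ray {k : ℕ} (R : Matrix (Fin 2) (Fin k) ℚ) (f : Fin 2 → ℚ)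
    (A B c C D d : ℤ) (j : Fin k) (t : ℝ) (hf : planeAffine C D d (realPoint f) ≠ 0)
    (h : planeAffine C D d (realPoint f + t • column R j) = 0) :
    ∃ q : ℚ, planeAffine A B c (realPoint f + t • column R j) = q := by
  rw [map_add_smul_column] at h
  simp only [planeAffine_linear_apply, column] at h
  have hl : (C : ℝ) * R 0 j + D * R 1 j ≠ 0 := by
    intro h0
    rw [h0, mul_zero, add_zero] at h
    exact hf h
  have ht : t = -planeAffine C D d (realPoint f) / (C * R 0 j + D * R 1 j) := by
    rw [eq_div_iff hl]; linarith
  refine ⟨A * f 0 + B * f 1 + c +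
    -(C * f 0 + D * f 1 + d) / (C * R 0 j + D * R 1 j) * (A * R 0 j + B * R 1 j), ?_⟩
  rw [map_add_smul_column, ht]
  simp only [planeAffine_apply, planeAffine_linear_apply, realPoint, column]
  push_cast
  ring

/-! ### Assembling the finite rank bound -/

theorem splitRank_lt_top {p q : ℕ} {C : Set ((Fin p → ℝ) × (Fin q → ℝ))} {a : Fin p → ℝ}
    {b : Fin q → ℝ} {c : ℝ} (n : ℕ) (h : IsValidIneq (splitClosure^[n] C) a b c) :
    splitRank C a b c < ⊤ :=
  (iInf₂_le n h).trans_lt (ENat.natCast_lt_top n)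

/-- The split step for inequalities that bound `∑ j, α j * s j` below by a combination of two
integer functionals. -/
theorem cost_bound_split_step {k : ℕ} (C₀ : Set ((Fin 2 → ℝ) × (Fin k → ℝ))) (w : Fin k → ℝ)
    (A B c C D d m₁ m₂ m₀ : ℤ) (n : ℕ) (α β γ : ℝ)
    (h₁ : ∀ z ∈ splitClosure^[n] C₀, m₁ * planeAffine A B c z.1 + m₂ * planeAffine C D d z.1 ≤ m₀ →
      α + β * planeAffine A B c z.1 + γ * planeAffine C D d z.1 ≤ ∑ j, w j * z.2 j)
    (h₂ : ∀ z ∈ splitClosure^[n] C₀,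
      (m₀ : ℝ) + 1 ≤ m₁ * planeAffine A B c z.1 + m₂ * planeAffine C D d z.1 →
      α + β * planeAffine A B c z.1 + γ * planeAffine C D d z.1 ≤ ∑ j, w j * z.2 j) :
    ∀ z ∈ splitClosure^[n + 1] C₀,
      α + β * planeAffine A B c z.1 + γ * planeAffine C D d z.1 ≤ ∑ j, w j * z.2 j := by
  simp only [planeAffine_apply] at h₁ h₂ ⊢
  -- A split in `(X, Y)` is a split in `x`: the coordinates are integral, and their constants `c`,
  -- `d` move into `π₀`.
  have key := isValidIneq_splitClosure (C := splitClosure^[n] C₀)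
    (a := ![β * A + γ * C, β * B + γ * D]) (b := -w) (c := -(α + β * c + γ * d))
    ![m₁ * A + m₂ * C, m₁ * B + m₂ * D] (m₀ - m₁ * c - m₂ * d)
    (by
      rintro z ⟨hz, hz'⟩
      simp only [Set.mem_ofPred_eq, Fin.sum_univ_two, Matrix.cons_val_zero, Matrix.cons_val_one,
        Pi.neg_apply, neg_mul, Finset.sum_neg_distrib] at hz' ⊢
      push_cast at hz'
      linarith [h₁ z hz (by linarith)])
    (by
      rintro z ⟨hz, hz'⟩
      simp only [Set.mem_ofPred_eq, Fin.sum_univ_two, Matrix.cons_val_zero, Matrix.cons_val_one,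
        Pi.neg_apply, neg_mul, Finset.sum_neg_distrib] at hz' ⊢
      push_cast at hz'
      linarith [h₂ z hz (by linarith)])
  intro z hz
  rw [Function.iterate_succ_apply'] at hz
  have := key z hz
  simp only [Fin.sum_univ_two, Matrix.cons_val_zero, Matrix.cons_val_one,
    Pi.neg_apply, neg_mul, Finset.sum_neg_distrib] at this
  linarith

theorem mainTheorem3 (k : ℕ) (R : Matrix (Fin 2) (Fin k) ℚ) (f : Fin 2 → ℚ)
    (hR : ∀ j, column R j ≠ 0)
    (hf : realPoint f ∉ integerPoints 2)
    (hP : (mixedIntegerSet R f).Nonempty)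
    (α : Fin k → ℝ) (hα : ∀ j, 0 ≤ α j)
    (hvalid : IsValidIneq (convexHull ℝ (mixedIntegerSet R f)) 0 (-α) (-1))
    (hT : IsTriangleT2A (inducedSet R f α)) :
    splitRank (relaxation R f) 0 (-α) (-1) < ⊤ := by
  obtain ⟨v, a, b, A, B, c, C, D, d, hTe, hYa, hYb, hYv, hXa, hXb, hva, hvb,
    ⟨p, hp, hpi⟩, ⟨q, hq, hqi⟩, ⟨e, he, hei⟩⟩ := exists_coordinates_of_isTriangleT2A hT
  set X := planeAffine A B c with hX
  set Y := planeAffine C D d with hY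
  have hvT : v ∈ inducedSet R f α := hTe ▸ subset_convexHull ℝ _ (by simp)
  have haT : a ∈ inducedSet R f α := hTe ▸ subset_convexHull ℝ _ (by simp)
  have hbT : b ∈ inducedSet R f α := hTe ▸ subset_convexHull ℝ _ (by simp)
  have hfT : realPoint f ∈ inducedSet R f α := realPoint_mem_inducedSet
  have hT₁ : inducedSet R f α = convexHull ℝ {v, b, a} := by rw [hTe, Set.pair_comm]
  have hT₂ : inducedSet R f α = convexHull ℝ {a, b, v} := by
    rw [hTe, Set.insert_comm, Set.pair_comm v b]
  -- the three sides
  obtain ⟨u₁, hu₁⟩ : ∃ u : (Fin 2 → ℝ) →ᵃ[ℝ] ℝ, ∀ x, u x = X x - X a * (1 - Y x) :=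
    ⟨X + X a • Y - AffineMap.const ℝ _ (X a), fun x => by simp; ring⟩
  obtain ⟨u₂, hu₂⟩ : ∃ u : (Fin 2 → ℝ) →ᵃ[ℝ] ℝ,
      ∀ x, u x = 1 - X x - (1 - X b) * (1 - Y x) :=
    ⟨AffineMap.const ℝ _ (X b) - X + (1 - X b) • Y, fun x => by simp; ring⟩
  have side₁ : ∀ x ∈ inducedSet R f α, 0 ≤ u₁ x ∧ (x ∉ segment ℝ v a → 0 < u₁ x) := by
    intro x hx
    rw [hTe] at hx
    apply nonneg_and_pos_of_side u₁ _ _ _ hx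
    · rw [hu₁, hva]; ring
    · rw [hu₁, hYa]; ring
    · rw [hu₁, hYb]; linarith
  have side₂ : ∀ x ∈ inducedSet R f α, 0 ≤ u₂ x ∧ (x ∉ segment ℝ v b → 0 < u₂ x) := by
    intro x hx
    rw [hT₁] at hx
    apply nonneg_and_pos_of_side u₂ _ _ _ hx
    · rw [hu₂, hvb]; ring
    · rw [hu₂, hYb]; ring
    · rw [hu₂, hYa]; linarith
  have side₃ : ∀ x ∈ inducedSet R f α, 0 ≤ Y x ∧ (x ∉ segment ℝ a b → 0 < Y x) := by
    intro x hx
    rw [hT₂] at hx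
    exact nonneg_and_pos_of_side Y hYa hYb (by linarith) hx
  -- Every side has an integer point in its relative interior, so `f` is on none of them.
  have hf₁ := (side₁ _ hfT).2 (realPoint_notMem_segment hf hα hvalid hvT haT hp hpi)
  have hf₂ := (side₂ _ hfT).2 (realPoint_notMem_segment hf hα hvalid hvT hbT hq hqi)
  have hf₃ := (side₃ _ hfT).2 (realPoint_notMem_segment hf hα hvalid haT hbT he hei)
  have pos₁ := fun x hx => (side₁ x hx).1
  have pos₂ := fun x hx => (side₂ x hx).1
  have pos₃ := fun x hx => (side₃ x hx).1
  -- the end points of the base are rational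
  obtain ⟨ra, hra⟩ : ∃ r : ℚ, X a = r := by
    obtain ⟨j, -, h1, h2⟩ := exists_column_of_mem_sides hα pos₃ pos₁ hf₃ haT hYa
      (by rw [hu₁, hYa]; ring)
    obtain ⟨r, hr⟩ := exists_rat_of_rational_ray R f A B c C D d j _ hf₃.ne' h1
    rw [hu₁, h1] at h2
    exact ⟨r, by rw [← hr]; linarith⟩
  obtain ⟨rb, hrb⟩ : ∃ r : ℚ, X b - 1 = r := by
    obtain ⟨j, -, h1, h2⟩ := exists_column_of_mem_sides hα pos₃ pos₂ hf₃ hbT hYb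
      (by rw [hu₂, hYb]; ring)
    obtain ⟨r, hr⟩ := exists_rat_of_rational_ray R f A B c C D d j _ hf₃.ne' h1
    rw [hu₂, h1] at h2
    exact ⟨r - 1, by push_cast; rw [← hr]; linarith⟩
  have hra0 : ra < 0 := by
    rw [hra] at hXa; exact_mod_cast hXa
  have hrb0 : 0 < rb := by
    have : (0 : ℝ) < rb := by rw [← hrb]; linarith
    exact_mod_cast this
  have hda : (0 : ℝ) < ra.den := by exact_mod_cast ra.den_pos
  have hdb : (0 : ℝ) < rb.den := by exact_mod_cast rb.den_pos
  have hna : (ra.den : ℝ) * X a = ra.num := by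
    rw [hra]; exact_mod_cast Rat.den_mul_eq_num ra
  have hnb : (rb.den : ℝ) * (X b - 1) = rb.num := by
    rw [hrb]; exact_mod_cast Rat.den_mul_eq_num rb
  -- Clearing the denominators of `X a` and `X b - 1` makes the side normals integral; `M` and `M'`
  -- are positive because `X a < 0` and `1 < X b`.
  obtain ⟨n, hn⟩ := exists_one_le_of_split_steps (fun n => splitClosure^[n] (relaxation R f))
    (fun z => ∑ j, α j * z.2 j) (fun z => X z.1) (fun z => Y z.1)
    (cost_bound_split_step (relaxation R f) α A B c C D d)
    (N := ra.den) (M := -ra.num) (N' := rb.den) (M' := rb.num)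
    (by exact_mod_cast ra.den_pos) (by simpa using hra0) (by exact_mod_cast rb.den_pos)
    (by simpa using hrb0)
    (c₁ := (u₁ (realPoint f))⁻¹ / ra.den) (c₂ := (u₂ (realPoint f))⁻¹ / rb.den)
    (c₃ := (Y (realPoint f))⁻¹)
    (div_pos (inv_pos.2 hf₁) hda) (div_pos (inv_pos.2 hf₂) hdb) (inv_pos.2 hf₃)
    (fun z hz => by
      have := one_sub_le_cost hα pos₁ hf₁ hz
      convert this using 2
      rw [div_mul_eq_mul_div, div_eq_iff hda.ne', hu₁ z.1]
      push_cast
      rw [← hna]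
      ring)
    (fun z hz => by
      have := one_sub_le_cost hα pos₂ hf₂ hz
      convert this using 2
      rw [div_mul_eq_mul_div, div_eq_iff hdb.ne', hu₂ z.1]
      push_cast
      rw [← hnb]
      ring)
    (fun z hz => one_sub_le_cost hα pos₃ hf₃ hz)
    (fun z hz => Finset.sum_nonneg fun j _ => mul_nonneg (hα j) (hz.2 j))
  apply splitRank_lt_top n
  intro z hz
  simpa using hn z hz
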